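/- All digraphs are finite and simple: they contain no self-loops and no multiple arcs with the same head and tail, but may contain both arcs $(u,v)$ and $(v,u)$. A digraph $D$ is semi-complete if for any two distinct vertices $u,v$ at least one of the arcs $(u,v)$, $(v,u)$ is present. For an ordering $\pi$ of the $n$ vertices of a digraph $D$ and $0\le i\le n$, the $i$-th cut of $\pi$ is the set of arcs $(u,v)$ of $D$ such that $v$ is among the first $i$ vertices of $\pi$ and $u$ is not. The width of $\pi$ is the maximum size of a cut of $\pi$ over $0\le i\le n$, and the cutwidth of $D$ is the minimum width over all orderings of its vertices. For a positive integer $c$, a digraph $D$ is called $c$-cutwidth-minimal if the cutwidth of $D$ is at least $c$, while every proper induced subdigraph of $D$ has cutwidth smaller than $c$. Theorem. For every positive integer $c$, every $c$-cutwidth-minimal semi-complete digraph has at most $24c^2+1$ vertices. -/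

import Mathlib

namespace Digraph

/-- A simple digraph is semi-complete if it has no self-loop and any two distinct vertices
are joined by at least one arc. (Multiple arcs do not exist in a `Digraph`.) -/
structure IsSemiComplete {V : Type*} (D : Digraph V) : Prop where
  loopless : ∀ v, ¬ D.Adj v v
  adj_or_adj : ∀ u v, u ≠ v → D.Adj u v ∨ D.Adj v u

/-- The subdigraph `D[X]` induced by a set `X` of vertices. -/
def induced {V : Type*} (D : Digraph V) (X : Set V) : Digraph X where
  Adj u v := D.Adj u v

/-- `E(X, Y)`: the set of arcs `(u, v)` with `u ∈ X` and `v ∈ Y`. -/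
def arcsBetween {V : Type*} (D : Digraph V) (X Y : Set V) : Set (V × V) :=
  {e | D.Adj e.1 e.2 ∧ e.1 ∈ X ∧ e.2 ∈ Y}

/-- A vertex ordering of a finite vertex set, with positions counted from `0`. -/
abbrev VertexOrdering (V : Type*) := V ≃ Fin (Nat.card V)

/-- The set of the first `i` vertices of the ordering `π`. -/
def VertexOrdering.firstVertices {V : Type*} (π : VertexOrdering V) (i : ℕ) : Set V :=
  {v | (π v : ℕ) < i}

/-- The cut of `π` after `i` vertices: all feedback arcs leading from a vertex outside the first
`i` vertices to a vertex among the first `i` vertices. -/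
def cut {V : Type*} (D : Digraph V) (π : VertexOrdering V) (i : ℕ) : Set (V × V) :=
  D.arcsBetween (π.firstVertices i)ᶜ (π.firstVertices i)

/-- The width of a vertex ordering: the maximum size of its cuts after `i = 0, 1, …, |V|`
vertices. -/
noncomputable def orderingWidth {V : Type*} (D : Digraph V) (π : VertexOrdering V) : ℕ :=
  (Finset.range (Nat.card V + 1)).sup fun i => (D.cut π i).ncard

/-- The cutwidth of a finite digraph: the minimum width among its vertex orderings. -/
noncomputable def cutwidth {V : Type*} (D : Digraph V) : ℕ :=
  ⨅ π : VertexOrdering V, D.orderingWidth π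

/-- `D` is `c`-cutwidth-minimal: its cutwidth is at least `c`, but every proper induced subdigraph
has cutwidth smaller than `c`. -/
structure IsCutwidthMinimal {V : Type*} (D : Digraph V) (c : ℕ) : Prop where
  le_cutwidth : c ≤ D.cutwidth
  cutwidth_induced_lt : ∀ X : Set V, X ≠ Set.univ → (D.induced X).cutwidth < c

end Digraph

/-! Put `k = c - 1`, so every `D - v` has an ordering of width at most `k`; if `D` is large, two
such orderings can be glued into one for `D`. By semi-completeness, positions and in-degrees differ
by at most about `k`. Hence there are `v` with no arcs into low in-degree vertices and `w` with no
arcs from high in-degree vertices. Take a set `A` separating low from high in-degree whose cut is at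
most `k` and minimum even in a wider window. Order `A` as in `D - v`, then the rest as in `D - w`.
For a prefix `X`, submodularity and minimality of `A` show that replacing `X` by `X ∩ A` or `X ∪ A`
does not increase its cut. -/

namespace Digraph

variable {V : Type*}

/-- The number of arcs entering `X`. -/
noncomputable def cutSize (D : Digraph V) (X : Set V) : ℕ := (D.arcsBetween Xᶜ X).ncard

/-- The in-degree of a vertex. -/
noncomputable def inDeg (D : Digraph V) (u : V) : ℕ := {y | D.Adj y u}.ncard

/-- `A` contains all vertices of in-degree less than `a`, and no vertex of in-degree at least
`b`. -/
def InWindow (D : Digraph V) (a b : ℕ) (A : Set V) : Prop :=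
  (∀ u, D.inDeg u < a → u ∈ A) ∧ ∀ u ∈ A, D.inDeg u < b

/-- Starting from a set in a window, one finds a set that is no worse and whose cut is minimum
even in a window wider by `s` on both sides. -/
theorem exists_cutSize_minimal (D : Digraph V) (s d : ℕ) : ∀ (a b : ℕ) (A : Set V),
    D.InWindow a b A → D.cutSize A ≤ d → ∃ a' b' A', a ≤ a' + s * d ∧ b' ≤ b + s * d ∧
      D.InWindow a' b' A' ∧ D.cutSize A' ≤ d ∧
      ∀ B, D.InWindow (a' - s) (b' + s) B → D.cutSize A' ≤ D.cutSize B := by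
  induction d with
  | zero =>
    intro a b A hA hd
    exact ⟨a, b, A, by omega, by omega, hA, hd, fun B _ => by omega⟩
  | succ d ih =>
    intro a b A hA hd
    by_cases hmin : ∀ B, D.InWindow (a - s) (b + s) B → D.cutSize A ≤ D.cutSize B
    · exact ⟨a, b, A, by omega, by omega, hA, hd, hmin⟩
    -- Each replacement lowers the cut by at least one and widens the window by `s`, so the total
    -- drift is at most `s` times the initial bound.
    · push Not at hmin
      obtain ⟨B, hB, hlt⟩ := hmin
      obtain ⟨a', b', A', h1, h2, h3, h4, h5⟩ := ih _ _ B hB (by omega)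
      rw [Nat.mul_succ]
      exact ⟨a', b', A', by omega, by omega, h3, by omega, h5⟩

variable [Finite V]

/-- The number of arcs entering a set is a submodular function. -/
theorem cutSize_inter_add_cutSize_union_le (D : Digraph V) (X Y : Set V) :
    D.cutSize (X ∩ Y) + D.cutSize (X ∪ Y) ≤ D.cutSize X + D.cutSize Y := by
  unfold cutSize
  rw [← Set.ncard_union_add_ncard_inter, ← Set.ncard_union_add_ncard_inter (D.arcsBetween Xᶜ X)]
  refine add_le_add (Set.ncard_le_ncard ?_) (Set.ncard_le_ncard ?_)
  · rintro ⟨p, q⟩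
    simp only [arcsBetween, Set.mem_union, Set.mem_ofPred_eq, Set.mem_compl_iff, Set.mem_inter_iff]
    tauto
  · rintro ⟨p, q⟩
    simp only [arcsBetween, Set.mem_union, Set.mem_ofPred_eq, Set.mem_compl_iff, Set.mem_inter_iff]
    tauto

/-! ### Orderings as numberings -/

/-- An injective numbering all of whose initial segments are entered by at most `k` arcs bounds
the cutwidth. -/
theorem cutwidth_le_of_injective (D : Digraph V) {f : V → ℕ} (hf : Function.Injective f) {k : ℕ}
    (hk : ∀ m, D.cutSize {u | f u < m} ≤ k) : D.cutwidth ≤ k := by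
  have := Fintype.ofFinite V
  let : LinearOrder V := LinearOrder.lift' f hf
  have hlt : ∀ u v : V, u < v ↔ f u < f v := fun _ _ => Iff.rfl
  let e := Fintype.orderIsoFinOfCardEq V (Nat.card_eq_fintype_card (α := V)).symm
  let π : VertexOrdering V := e.toEquiv.symm
  have hπ : ∀ u, π u = e.symm u := fun _ => rfl
  have hle : D.cutwidth ≤ D.orderingWidth π := Nat.sInf_le (Set.mem_range_self π)
  refine hle.trans (Finset.sup_le fun i _ => ?_)
  have key : ∃ m, π.firstVertices i = {u | f u < m} := by
    by_cases hi : i < Nat.card V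
    · refine ⟨f (e ⟨i, hi⟩), ?_⟩
      ext u
      simp only [VertexOrdering.firstVertices, Set.mem_ofPred_eq, ← hlt, hπ]
      rw [← OrderIso.symm_apply_lt, Fin.lt_def]
    · obtain ⟨M, hM⟩ := (Set.finite_range f).bddAbove
      refine ⟨M + 1, ?_⟩
      ext u
      simp only [VertexOrdering.firstVertices, Set.mem_ofPred_eq]
      have h1 := hM ⟨u, rfl⟩
      have h2 := (π u).isLt
      constructor <;> intro <;> omega
  obtain ⟨m, hm⟩ := key
  unfold cut
  rw [hm]
  exact hk m

/-- `f` numbers the vertices other than `v` as `0, 1, …`, so that the cuts of the resulting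
ordering of `D - v` have at most `k` arcs. -/
structure IsNumberingAvoiding (D : Digraph V) (v : V) (k : ℕ) (f : V → ℕ) : Prop where
  injOn : Set.InjOn f {v}ᶜ
  ncard_lt : ∀ m < Nat.card V, {u | u ≠ v ∧ f u < m}.ncard = m
  lt_card : ∀ u, f u < Nat.card V
  ncard_arcs_le : ∀ m,
    (D.arcsBetween {u | u ≠ v ∧ m ≤ f u} {u | u ≠ v ∧ f u < m}).ncard ≤ k

theorem ncard_equiv_fin_lt {W : Type*} {N : ℕ} (e : W ≃ Fin N) {m : ℕ} (hm : m ≤ N) :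
    {w | (e w : ℕ) < m}.ncard = m := by
  have h : {w | (e w : ℕ) < m} = e.symm '' (Set.range (Fin.castLE hm)) := by
    ext w
    simp only [Set.mem_ofPred_eq, Set.mem_image, Set.mem_range]
    constructor
    · intro h
      exact ⟨e w, ⟨⟨e w, h⟩, rfl⟩, by simp⟩
    · rintro ⟨_, ⟨j, rfl⟩, rfl⟩
      simp
  rw [h, Set.ncard_image_of_injective _ e.symm.injective, ← Set.image_univ,
    Set.ncard_image_of_injective _ (Fin.castLE_injective hm), Set.ncard_univ, Nat.card_fin]

theorem exists_isNumberingAvoiding (D : Digraph V) (v : V) {k : ℕ}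
    (h : (D.induced {v}ᶜ).cutwidth ≤ k) : ∃ f, D.IsNumberingAvoiding v k f := by
  classical
  set W : Set V := {v}ᶜ with hW
  have hcard : Nat.card W + 1 = Nat.card V := by
    have := Set.ncard_add_ncard_compl ({v} : Set V)
    rw [Set.ncard_singleton, ← hW] at this
    rw [Nat.card_coe_set_eq]
    omega
  have hne : Nonempty (VertexOrdering W) := ⟨Finite.equivFin W⟩
  obtain ⟨π, hπ⟩ : ∃ π : VertexOrdering W, (D.induced W).orderingWidth π ≤ k := by
    obtain ⟨π, hπ⟩ := Nat.sInf_mem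
      (Set.range_nonempty fun π : VertexOrdering W => (D.induced W).orderingWidth π)
    exact ⟨π, hπ.trans_le h⟩
  let f : V → ℕ := fun u => if hu : u ∈ W then π ⟨u, hu⟩ else 0
  have hfW : ∀ u : W, f u = π u := fun u => by simp [f, u.2]
  have hlt : ∀ u ∈ W, f u < Nat.card W := fun u hu => by
    have := hfW ⟨u, hu⟩
    simp only at this
    rw [this]
    exact (π ⟨u, hu⟩).isLt
  have hset : ∀ m, {u | u ≠ v ∧ f u < m} = Subtype.val '' {w : W | (π w : ℕ) < m} := fun m => by
    ext u
    simp only [Set.mem_ofPred_eq, Set.mem_image]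
    constructor
    · rintro ⟨hu, hm⟩
      exact ⟨⟨u, hu⟩, by rwa [← hfW], rfl⟩
    · rintro ⟨w, hw, rfl⟩
      exact ⟨w.2, by rwa [hfW]⟩
  refine ⟨f, ⟨?_, ?_, ?_, ?_⟩⟩
  · intro x hx y hy hxy
    have h1 := hfW ⟨x, hx⟩
    have h2 := hfW ⟨y, hy⟩
    have : π ⟨x, hx⟩ = π ⟨y, hy⟩ := Fin.ext (by rw [← h1, ← h2]; exact hxy)
    exact congrArg Subtype.val (π.injective this)
  · intro m hm
    rw [hset, Set.ncard_image_of_injective _ Subtype.val_injective]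
    exact ncard_equiv_fin_lt π (by omega)
  · intro u
    by_cases hu : u ∈ W
    · exact (hlt u hu).trans (by omega)
    · simp only [f, hu, dite_false]
      omega
  · intro m
    by_cases hm : m ≤ Nat.card W
    · have h1 : ((D.induced W).cut π m).ncard ≤ k :=
        (Finset.le_sup (f := fun i => ((D.induced W).cut π i).ncard)
          (Finset.mem_range.2 (by omega))).trans hπ
      refine le_trans ?_ h1
      have hinj : Function.Injective (Prod.map (Subtype.val : W → V) (Subtype.val : W → V)) :=
        Subtype.val_injective.prodMap Subtype.val_injective
      rw [← Set.ncard_image_of_injective _ hinj]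
      refine Set.ncard_le_ncard ?_
      rintro ⟨p, q⟩ ⟨hpq, ⟨hp, hpm⟩, hq, hqm⟩
      refine ⟨(⟨p, hp⟩, ⟨q, hq⟩), ⟨hpq, ?_, ?_⟩, rfl⟩
      · have := hfW ⟨p, hp⟩
        simp only [VertexOrdering.firstVertices, Set.mem_compl_iff, Set.mem_ofPred_eq, not_lt]
        exact this ▸ hpm
      · have := hfW ⟨q, hq⟩
        simp only [VertexOrdering.firstVertices, Set.mem_ofPred_eq]
        exact this ▸ hqm
    · have : D.arcsBetween {u | u ≠ v ∧ m ≤ f u} {u | u ≠ v ∧ f u < m} = ∅ := by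
        refine Set.eq_empty_of_forall_notMem ?_
        rintro ⟨p, q⟩ ⟨-, ⟨hp, hpm⟩, -⟩
        have := hlt p hp
        simp only at hpm
        omega
      simp [this]

/-! ### In-degree against position -/

namespace IsNumberingAvoiding

variable {D : Digraph V} {v : V} {k : ℕ} {f : V → ℕ}

/-- Each of the `f u` predecessors of `u` sends an arc to `u`, except at most `k` that are heads of
backward arcs from `u`. -/
theorem le_inDeg_add (hD : D.IsSemiComplete) (h : D.IsNumberingAvoiding v k f) {u : V}
    (hu : u ≠ v) : f u ≤ D.inDeg u + k := by
  have hback : {y | D.Adj u y ∧ y ≠ v ∧ f y < f u}.ncard ≤ k := by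
    refine le_trans ?_ (h.ncard_arcs_le (f u))
    rw [← Set.ncard_image_of_injective _ (Prod.mk_right_injective u)]
    refine Set.ncard_le_ncard ?_
    rintro _ ⟨y, ⟨hy, hyv, hyf⟩, rfl⟩
    exact ⟨hy, ⟨hu, le_rfl⟩, hyv, hyf⟩
  rw [← h.ncard_lt _ (h.lt_card u)]
  refine (Set.ncard_le_ncard (t := {y | D.Adj y u} ∪ {y | D.Adj u y ∧ y ≠ v ∧ f y < f u})
    ?_).trans ((Set.ncard_union_le _ _).trans (Nat.add_le_add_left hback _))
  rintro y ⟨hyv, hyf⟩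
  have hne : y ≠ u := by
    rintro rfl
    exact lt_irrefl _ hyf
  rcases hD.adj_or_adj y u hne with h' | h'
  · exact Or.inl h'
  · exact Or.inr ⟨h', hyv, hyf⟩

/-- In-neighbours of `u` are predecessors, tails of backward arcs, or `v` itself, whence the `+ 1`.
-/
theorem inDeg_le_add (hD : D.IsSemiComplete) (h : D.IsNumberingAvoiding v k f) {u : V}
    (hu : u ≠ v) : D.inDeg u ≤ f u + k + 1 := by
  have hback : {y | D.Adj y u ∧ y ≠ v ∧ f u + 1 ≤ f y}.ncard ≤ k := by
    refine le_trans ?_ (h.ncard_arcs_le (f u + 1))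
    rw [← Set.ncard_image_of_injective _ (Prod.mk_left_injective u)]
    refine Set.ncard_le_ncard ?_
    rintro _ ⟨y, ⟨hy, hyv, hyf⟩, rfl⟩
    exact ⟨hy, ⟨hyv, hyf⟩, hu, Nat.lt_succ_self _⟩
  have hcard := h.ncard_lt _ (h.lt_card u)
  have hsub : {y | D.Adj y u} ⊆
      ({y | y ≠ v ∧ f y < f u} ∪ {y | D.Adj y u ∧ y ≠ v ∧ f u + 1 ≤ f y}) ∪ {v} := by
    intro y hy
    by_cases hyv : y = v
    · exact Or.inr hyv
    rcases lt_trichotomy (f y) (f u) with hlt | heq | hgt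
    · exact Or.inl (Or.inl ⟨hyv, hlt⟩)
    · have := h.injOn hyv hu heq
      subst this
      exact absurd hy (hD.loopless y)
    · exact Or.inl (Or.inr ⟨hy, hyv, hgt⟩)
  have h1 := Set.ncard_le_ncard hsub
  have h2 := Set.ncard_union_le
    ({y | y ≠ v ∧ f y < f u} ∪ {y | D.Adj y u ∧ y ≠ v ∧ f u + 1 ≤ f y}) {v}
  have h3 := Set.ncard_union_le
    {y | y ≠ v ∧ f y < f u} {y | D.Adj y u ∧ y ≠ v ∧ f u + 1 ≤ f y}
  rw [Set.ncard_singleton] at h2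
  unfold inDeg
  omega

theorem inDeg_le_of_lt (hD : D.IsSemiComplete) (h : D.IsNumberingAvoiding v k f) {x y : V}
    (hx : x ≠ v) (hy : y ≠ v) (hxy : f x < f y) : D.inDeg x ≤ D.inDeg y + 2 * k := by
  have := h.inDeg_le_add hD hx
  have := h.le_inDeg_add hD hy
  omega

end IsNumberingAvoiding

/-! ### The vertices `v` and `w` -/

/-- Some vertex sends no arc to the vertices of in-degree less than `b`. -/
theorem exists_not_adj_of_inDeg_lt {D : Digraph V} (hD : D.IsSemiComplete) {k b : ℕ}
    (hmin : ∀ v, ∃ f, D.IsNumberingAvoiding v k f) (hb : b + 2 * k + 2 ≤ Nat.card V) :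
    ∃ v, b ≤ D.inDeg v ∧ ∀ y, D.inDeg y < b → ¬ D.Adj v y := by
  have : Nonempty V := (Nat.card_pos_iff.1 (by omega)).1
  -- Deleting a vertex of maximum in-degree keeps every vertex of in-degree below `b` in the
  -- ordering.
  obtain ⟨x, hx⟩ := Finite.exists_max D.inDeg
  obtain ⟨f, hf⟩ := hmin x
  have hq := hf.ncard_lt (b + k) (by omega)
  have harcs := hf.ncard_arcs_le (b + k)
  have hlate : k < {u | u ≠ x ∧ b + k ≤ f u}.ncard := by
    have hun : ({u | u ≠ x ∧ f u < b + k} ∪ {u | u ≠ x ∧ b + k ≤ f u}) ∪ {x} = Set.univ := by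
      ext u
      simp only [Set.mem_union, Set.mem_ofPred_eq, Set.mem_singleton_iff, Set.mem_univ, iff_true]
      have := lt_or_ge (f u) (b + k)
      tauto
    have h1 := Set.ncard_union_le
      ({u | u ≠ x ∧ f u < b + k} ∪ {u | u ≠ x ∧ b + k ≤ f u}) {x}
    have h2 := Set.ncard_union_le {u | u ≠ x ∧ f u < b + k} {u | u ≠ x ∧ b + k ≤ f u}
    rw [hun, Set.ncard_univ, Set.ncard_singleton] at h1
    omega
  -- More than `k` vertices lie after the cut, but at most `k` are tails of its arcs.
  obtain ⟨v, ⟨hvx, hvf⟩, hv⟩ := Set.exists_mem_notMem_of_ncard_lt_ncard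
    (((Set.ncard_image_le (f := Prod.fst)).trans harcs).trans_lt hlate)
  have hbv : b ≤ D.inDeg v := by
    have := hf.le_inDeg_add hD hvx
    omega
  refine ⟨v, hbv, fun y hy hadj => hv ⟨(v, y), ⟨hadj, ⟨hvx, hvf⟩, ?_, ?_⟩, rfl⟩⟩
  · intro h
    have h : y = x := h
    subst h
    exact absurd (hx v) (by omega)
  · have hyx : y ≠ x := by
      rintro rfl
      exact absurd (hx v) (by omega)
    have := hf.le_inDeg_add hD hyx
    change f y < b + k
    omega

/-- Some vertex receives no arc from the vertices of in-degree at least `a`. -/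
theorem exists_not_adj_of_le_inDeg {D : Digraph V} (hD : D.IsSemiComplete) {k a : ℕ}
    (hmin : ∀ v, ∃ f, D.IsNumberingAvoiding v k f) (ha : 2 * k + 2 ≤ a)
    (hk : k + 2 ≤ Nat.card V) :
    ∃ w, D.inDeg w < a ∧ ∀ y, a ≤ D.inDeg y → ¬ D.Adj y w := by
  have : Nonempty V := (Nat.card_pos_iff.1 (by omega)).1
  obtain ⟨x, hx⟩ := Finite.exists_min D.inDeg
  obtain ⟨f, hf⟩ := hmin x
  have hq := hf.ncard_lt (k + 1) (by omega)
  have harcs := hf.ncard_arcs_le (k + 1)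
  obtain ⟨w, ⟨hwx, hwf⟩, hw⟩ := Set.exists_mem_notMem_of_ncard_lt_ncard
    (((Set.ncard_image_le (f := Prod.snd)).trans harcs).trans_lt
      (show k < {u | u ≠ x ∧ f u < k + 1}.ncard by omega))
  have hwa : D.inDeg w < a := by
    have := hf.inDeg_le_add hD hwx
    omega
  refine ⟨w, hwa, fun y hy hadj => ?_⟩
  have hyx : y ≠ x := by
    rintro rfl
    exact absurd (hx w) (by omega)
  refine hw ⟨(y, w), ⟨hadj, ⟨hyx, ?_⟩, hwx, hwf⟩, rfl⟩
  have := hf.inDeg_le_add hD hyx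
  change k + 1 ≤ f y
  omega

/-- Deleting a vertex `v ∉ X` without arcs to `X` does not change the cut of `X`. -/
theorem IsNumberingAvoiding.cutSize_le_of_forall_not_adj {D : Digraph V} {v : V} {k : ℕ}
    {f : V → ℕ} (h : D.IsNumberingAvoiding v k f) (m : ℕ)
    (hv : ∀ y, y ≠ v → f y < m → ¬ D.Adj v y) : D.cutSize {u | u ≠ v ∧ f u < m} ≤ k := by
  refine (Set.ncard_le_ncard ?_).trans (h.ncard_arcs_le m)
  rintro ⟨p, q⟩ ⟨hpq, hp, hq⟩
  have hpv : p ≠ v := by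
    rintro rfl
    exact hv q hq.1 hq.2 hpq
  refine ⟨hpq, ⟨hpv, not_lt.1 fun hlt => hp ⟨hpv, hlt⟩⟩, hq⟩

/-- Deleting a vertex `w ∈ X` without arcs from outside `X` does not change the cut of `X`. -/
theorem IsNumberingAvoiding.cutSize_insert_le_of_forall_not_adj {D : Digraph V} {w : V} {k : ℕ}
    {f : V → ℕ} (h : D.IsNumberingAvoiding w k f) (m : ℕ)
    (hw : ∀ y, y ≠ w → m ≤ f y → ¬ D.Adj y w) : D.cutSize {u | u = w ∨ f u < m} ≤ k := by
  refine (Set.ncard_le_ncard ?_).trans (h.ncard_arcs_le m)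
  rintro ⟨p, q⟩ ⟨hpq, hp, hq⟩
  simp only [Set.mem_compl_iff, Set.mem_ofPred_eq, not_or, not_lt] at hp hq hpq
  have hqw : q ≠ w := by
    rintro rfl
    exact hw p hp.1 hp.2 hpq
  exact ⟨hpq, hp, hqw, hq.resolve_left hqw⟩

/-! ### Gluing two orderings -/

/-- If deleting any vertex leaves cutwidth at most `k` and there are many vertices, then the
cutwidth is at most `k`: an ordering of `D - v` on a suitable set `A` is followed by an ordering
of `D - w` on its complement. -/
theorem cutwidth_le_of_forall_isNumberingAvoiding {D : Digraph V} (hD : D.IsSemiComplete) {k : ℕ}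
    (hmin : ∀ v, ∃ f, D.IsNumberingAvoiding v k f)
    (hcard : 4 * k ^ 2 + 10 * k + 5 ≤ Nat.card V) : D.cutwidth ≤ k := by
  -- `K` is the drift allowed to the window: at most `k` widenings by `2 * k`. The thresholds for
  -- `v` and `w` leave room for it on both sides, plus one last widening.
  obtain ⟨K, hK⟩ : ∃ K, K = 2 * k * k := ⟨_, rfl⟩
  have hcard' : 2 * K + 10 * k + 5 ≤ Nat.card V := by
    rw [hK]
    linarith [hcard, pow_two k]
  obtain ⟨v, hvb, hv⟩ := exists_not_adj_of_inDeg_lt hD (b := 2 * K + 8 * k + 3) hmin (by omega)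
  obtain ⟨w, hwa, hw⟩ := exists_not_adj_of_le_inDeg hD (a := 2 * k + 2) hmin le_rfl (by omega)
  obtain ⟨f, hf⟩ := hmin v
  obtain ⟨g, hg⟩ := hmin w
  obtain ⟨a, b, A, ha, hb, ⟨hA1, hA2⟩, hAk, hAmin⟩ :
      ∃ a b A, 4 * k + 2 ≤ a ∧ b + 2 * k ≤ 2 * K + 8 * k + 3 ∧ D.InWindow a b A ∧
        D.cutSize A ≤ k ∧
        ∀ B, D.InWindow (a - 2 * k) (b + 2 * k) B → D.cutSize A ≤ D.cutSize B := by
    have hlow : ∀ y, y ≠ v → f y < K + 5 * k + 2 → D.inDeg y < K + 6 * k + 3 := fun y hy hyf => by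
      have := hf.inDeg_le_add hD hy
      omega
    have hY := hf.cutSize_le_of_forall_not_adj (K + 5 * k + 2)
      fun y hy hyf => hv y (by have := hlow y hy hyf; omega)
    have hwin : D.InWindow (K + 4 * k + 2) (K + 6 * k + 3)
        {u | u ≠ v ∧ f u < K + 5 * k + 2} := by
      refine ⟨fun u hu => ?_, fun u hu => hlow u hu.1 hu.2⟩
      have huv : u ≠ v := by
        rintro rfl
        omega
      have := hf.le_inDeg_add hD huv
      exact ⟨huv, by omega⟩
    obtain ⟨a, b, A, h1, h2, h3, h4, h5⟩ := D.exists_cutSize_minimal (2 * k) k _ _ _ hwin hY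
    exact ⟨a, b, A, by omega, by omega, h3, h4, h5⟩
  have hvA : v ∉ A := fun h => by
    have := hA2 v h
    omega
  have hwA : w ∈ A := hA1 w (by omega)
  have hleft : ∀ m, D.cutSize ({u | u ≠ v ∧ f u < m} ∩ A) ≤ k := by
    intro m
    by_cases hX : ∀ u, u ≠ v → f u < m → D.inDeg u < b + 2 * k
    · have h1 := hf.cutSize_le_of_forall_not_adj m
        fun y hy hyf => hv y (by have := hX y hy hyf; omega)
      have h2 := D.cutSize_inter_add_cutSize_union_le {u | u ≠ v ∧ f u < m} A
      have h3 := hAmin ({u | u ≠ v ∧ f u < m} ∪ A)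
        ⟨fun u hu => Or.inr (hA1 u (by omega)), fun u hu => hu.elim (fun h => hX u h.1 h.2)
          fun h => by have := hA2 u h; omega⟩
      omega
    · push Not at hX
      obtain ⟨r, hrv, hrm, hr⟩ := hX
      -- A vertex of `A` outside the prefix would come after `r`, forcing `D.inDeg r < b + 2 * k`.
      have : {u | u ≠ v ∧ f u < m} ∩ A = A := by
        refine Set.inter_eq_right.2 fun u hu => ?_
        have huv : u ≠ v := fun h => hvA (h ▸ hu)
        refine ⟨huv, ?_⟩
        by_contra hum
        have := hf.inDeg_le_of_lt hD hrv huv (by omega)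
        have := hA2 u hu
        omega
      rwa [this]
  have hright : ∀ m, D.cutSize ({u | u = w ∨ g u < m} ∪ A) ≤ k := by
    intro m
    by_cases hX : ∀ u, D.inDeg u < a - 2 * k → u = w ∨ g u < m
    · have h1 := hg.cutSize_insert_le_of_forall_not_adj m fun y hy hyg => hw y (by
        by_contra hlt
        rcases hX y (by omega) with h | h
        · exact hy h
        · omega)
      have h2 := D.cutSize_inter_add_cutSize_union_le {u | u = w ∨ g u < m} A
      have h3 := hAmin ({u | u = w ∨ g u < m} ∩ A)
        ⟨fun u hu => ⟨hX u hu, hA1 u (by omega)⟩, fun u hu => by have := hA2 u hu.2; omega⟩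
      omega
    · push Not at hX
      obtain ⟨l, hl, hlw, hlm⟩ := hX
      have : {u | u = w ∨ g u < m} ∪ A = A := by
        refine Set.union_eq_right.2 fun u hu => ?_
        by_cases huw : u = w
        · exact huw ▸ hwA
        have hum : g u < m := hu.resolve_left huw
        have := hg.inDeg_le_of_lt hD huw hlw (by omega)
        exact hA1 u (by omega)
      rwa [this]
  classical
  -- As `f < Nat.card V`, the shift puts the complement of `A` after `A`.
  refine D.cutwidth_le_of_injective
    (f := fun u => if u ∈ A then f u else Nat.card V + g u) ?_ fun m => ?_
  · intro x y hxy
    have hx := hf.lt_card x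
    have hy := hf.lt_card y
    simp only at hxy
    split_ifs at hxy with h1 h2 h2
    · exact hf.injOn (fun h => hvA (h ▸ h1)) (fun h => hvA (h ▸ h2)) hxy
    · omega
    · omega
    · exact hg.injOn (fun h : x = w => h1 (h ▸ hwA)) (fun h : y = w => h2 (h ▸ hwA)) (by omega)
  · rcases le_total m (Nat.card V) with hm | hm
    · convert hleft m using 2
      ext u
      by_cases hu : u ∈ A
      · have huv : u ≠ v := fun h => hvA (h ▸ hu)
        simp [hu, huv]
      · simp only [Set.mem_ofPred_eq, hu, if_false, Set.mem_inter_iff, and_false, iff_false]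
        omega
    · convert hright (m - Nat.card V) using 2
      ext u
      by_cases hu : u ∈ A
      · have := hf.lt_card u
        simp only [Set.mem_ofPred_eq, hu, if_true, Set.mem_union, or_true, iff_true]
        omega
      · have huw : u ≠ w := fun h => hu (h ▸ hwA)
        simp only [Set.mem_ofPred_eq, hu, if_false, Set.mem_union, or_false, huw, false_or]
        omega

end Digraph

theorem mainTheorem5 (c : ℕ) (hc : 0 < c) {V : Type*} [Finite V] (D : Digraph V)
    (hD : D.IsSemiComplete) (hmin : D.IsCutwidthMinimal c) :
    Nat.card V ≤ 24 * c ^ 2 + 1 := by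
  by_contra hn
  obtain ⟨k, rfl⟩ : ∃ k, c = k + 1 := ⟨c - 1, by omega⟩
  have hle : D.cutwidth ≤ k := by
    refine Digraph.cutwidth_le_of_forall_isNumberingAvoiding hD (fun v => ?_) ?_
    · exact D.exists_isNumberingAvoiding v (Nat.lt_succ_iff.1
        (hmin.cutwidth_induced_lt _ fun h => (h ▸ Set.mem_univ v : v ∈ ({v}ᶜ : Set V)) rfl))
    -- There is slack: `4 * k ^ 2 + 10 * k + 5` vertices already suffice.
    · nlinarith
  exact absurd hmin.le_cutwidth (by omega)
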